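/- Let $(X,d)$ be a non-empty proper geodesic Gromov hyperbolic metric space, with Gromov compactification $\overline X^G=X\sqcup\partial_GX$, where $\partial_GX$ is the set of geodesic rays modulo bounded distance. Let $\overline X^H$ be its horofunction compactification, i.e. the closure of the image of $X$ under $x\mapsto[d(x,\cdot)]$ in $C(X)/\{\text{constants}\}$, where $C(X)$ carries the topology of uniform convergence on compact sets. Assume that $\overline X^H$ and $\overline X^G$ are topologically equivalent, i.e. that there is a homeomorphism $\overline X^H\to\overline X^G$ compatible with the two inclusions of $X$. Let $f\colon X\to X$ be non-expanding, i.e. $d(f(x),f(y))\le d(x,y)$ for all $x,y\in X$, and suppose that no forward orbit $(f^n(x))_{n\ge0}$ has a bounded subsequence. For $\eta\in\partial_GX$ and $p\in X$ define the dilation $\lambda_{\eta,p}\in(0,+\infty]$ by $$\log\lambda_{\eta,p}=\liminf_{z\to\eta}\bigl(d(z,p)-d(f(z),p)\bigr),$$ where $z\in X$ tends to $\eta$ in $\overline X^G$. Call $\eta$ a boundary regular fixed point of $f$ if $\lambda_{\eta,p}<+\infty$ for all $p\in X$ and if $f(x_n)\to\eta$ in $\overline X^G$ for every sequence $(x_n)$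 in $X$ that converges to $\eta$ and stays at bounded distance from some geodesic ray representing $\eta$. Then there is a unique $\zeta\in\partial_GX$, the Denjoy–Wolff point of $f$, such that $f^n(x)\to\zeta$ in $\overline X^G$ for all $x\in X$. The point $\zeta$ is a boundary regular fixed point of $f$ with $\lambda_{\zeta,p}\le1$ for every $p\in X$, and every boundary regular fixed point $\eta$ of $f$ with $\lambda_{\eta,p}\le1$ for some $p\in X$ equals $\zeta$. Moreover the divergence rate $c(f):=\lim_{n\to\infty}d(x,f^n(x))/n$ exists in $\mathbb R$, does not depend on $x\in X$, and $$c(f)=-\log\lambda_{\zeta,p}\qquad\text{for every }p\in X;$$ in particular $\lambda_\zeta:=\lambda_{\zeta,p}$ does not depend on $p$. -/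

import Mathlib

open Filter Topology
open scoped NNReal ENNReal

/-! ### Geodesic and Gromov hyperbolic metric spaces -/

/-- Any two points are joined by a geodesic segment. -/
def IsGeodesicSpace (X : Type*) [MetricSpace X] : Prop :=
  ∀ x y : X, ∃ γ : ℝ → X, γ 0 = x ∧ γ (dist x y) = y ∧
    ∀ s ∈ Set.Icc 0 (dist x y), ∀ t ∈ Set.Icc 0 (dist x y), dist (γ s) (γ t) = |s - t|

/-- The Gromov product `(x | y)_p`. -/
noncomputable def gromovProduct {X : Type*} [MetricSpace X] (p x y : X) : ℝ :=
  (dist x p + dist y p - dist x y) / 2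

/-- Gromov hyperbolicity (four point condition, for some constant `δ`). -/
def IsGromovHyperbolic (X : Type*) [MetricSpace X] : Prop :=
  ∃ δ : ℝ, ∀ p x y z : X,
    min (gromovProduct p x y) (gromovProduct p y z) - δ ≤ gromovProduct p x z

/-! ### The Gromov compactification -/

/-- Geodesic rays `γ : [0, +∞) → X`. -/
def GeodesicRay (X : Type*) [MetricSpace X] : Type _ :=
  {γ : ℝ≥0 → X // Isometry γ}

/-- Two rays are asymptotic if `t ↦ d(γ(t), σ(t))` is bounded. -/
def Asymptotic {X : Type*} [MetricSpace X] (γ σ : GeodesicRay X) : Prop :=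
  ∃ C : ℝ, ∀ t : ℝ≥0, dist (γ.1 t) (σ.1 t) ≤ C

/-- Being asymptotic is an equivalence relation on rays. -/
def asymptoticSetoid (X : Type*) [MetricSpace X] : Setoid (GeodesicRay X) where
  r := Asymptotic
  iseqv :=
    { refl := fun γ => ⟨0, fun t => by simp⟩
      symm := by
        rintro γ σ ⟨C, hC⟩
        exact ⟨C, fun t => by rw [dist_comm]; exact hC t⟩
      trans := by
        rintro γ σ τ ⟨C, hC⟩ ⟨D, hD⟩
        exact ⟨C + D, fun t => (dist_triangle _ (σ.1 t) _).trans (add_le_add (hC t) (hD t))⟩ }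

/-- The Gromov boundary: geodesic rays up to asymptoticity. -/
def GromovBoundary (X : Type*) [MetricSpace X] : Type _ :=
  Quotient (asymptoticSetoid X)

/-- The boundary point represented by a ray. -/
def GeodesicRay.endpoint {X : Type*} [MetricSpace X] (γ : GeodesicRay X) : GromovBoundary X :=
  Quotient.mk (asymptoticSetoid X) γ

/-- The underlying set of the Gromov compactification, the disjoint union of `X` and of its
Gromov boundary. -/
inductive GromovCompactification (X : Type*) [MetricSpace X]
  | point (x : X) : GromovCompactification X
  | ideal (ξ : GromovBoundary X) : GromovCompactification X

/-- The basic neighbourhood of the boundary point `ξ`, of size `R` and seen from `p`: the points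
`x` such that, for some ray `γ` representing `ξ`, eventually `(x | γ(t))_p ≥ R`, and the boundary
points `η` such that, for some rays `γ` and `σ` representing `ξ` and `η`, eventually
`(σ(t) | γ(t))_p ≥ R`. -/
def gromovNhd {X : Type*} [MetricSpace X] (p : X) (ξ : GromovBoundary X) (R : ℝ) :
    Set (GromovCompactification X) :=
  {a | match a with
    | .point x => ∃ γ : GeodesicRay X, γ.endpoint = ξ ∧
        ∀ᶠ t in atTop, R ≤ gromovProduct p x (γ.1 t)
    | .ideal η => ∃ γ σ : GeodesicRay X, γ.endpoint = ξ ∧ σ.endpoint = η ∧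
        ∀ᶠ t in atTop, R ≤ gromovProduct p (σ.1 t) (γ.1 t)}

/-- The neighbourhoods shrink as `R` grows. -/
theorem gromovNhd_anti {X : Type*} [MetricSpace X] (p : X) (ξ : GromovBoundary X) {R S : ℝ}
    (h : R ≤ S) : gromovNhd p ξ S ⊆ gromovNhd p ξ R := by
  rintro (x | η)
  · rintro ⟨γ, h₁, h₂⟩
    exact ⟨γ, h₁, h₂.mono fun t ht => h.trans ht⟩
  · rintro ⟨γ, σ, h₁, h₂, h₃⟩
    exact ⟨γ, σ, h₁, h₂, h₃.mono fun t ht => h.trans ht⟩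

/-- The topology of the Gromov compactification: `X` is open and carries its own topology, and
for proper geodesic Gromov hyperbolic `X` the sets `gromovNhd p ξ R`, `R : ℝ`, form a neighbourhood
basis of the boundary point `ξ` (for any base point `p`). -/
instance gromovTopology (X : Type*) [MetricSpace X] :
    TopologicalSpace (GromovCompactification X) where
  IsOpen U := IsOpen {x : X | GromovCompactification.point x ∈ U} ∧
    ∀ ξ : GromovBoundary X, GromovCompactification.ideal ξ ∈ U →
      ∀ p : X, ∃ R : ℝ, gromovNhd p ξ R ⊆ U
  isOpen_univ := by
    refine ⟨by simp, fun ξ _ p => ⟨0, Set.subset_univ _⟩⟩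
  isOpen_inter := by
    rintro U V ⟨hU, hU'⟩ ⟨hV, hV'⟩
    refine ⟨hU.inter hV, fun ξ hξ p => ?_⟩
    obtain ⟨R, hR⟩ := hU' ξ hξ.1 p
    obtain ⟨S, hS⟩ := hV' ξ hξ.2 p
    exact ⟨max R S, Set.subset_inter ((gromovNhd_anti p ξ (le_max_left R S)).trans hR)
      ((gromovNhd_anti p ξ (le_max_right R S)).trans hS)⟩
  isOpen_sUnion := by
    intro 𝒰 h𝒰
    refine ⟨?_, ?_⟩
    · have : {x : X | GromovCompactification.point x ∈ ⋃₀ 𝒰} =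
          ⋃ U ∈ 𝒰, {x : X | GromovCompactification.point x ∈ U} := by
        ext x
        simp
      rw [this]
      exact isOpen_biUnion fun U hU => (h𝒰 U hU).1
    · rintro ξ ⟨U, hU, hξ⟩ p
      obtain ⟨R, hR⟩ := (h𝒰 U hU).2 ξ hξ p
      exact ⟨R, hR.trans (Set.subset_sUnion_of_mem hU)⟩

/-! ### The horofunction compactification -/

/-- The subspace of constant functions in `C(X)` (with the topology of uniform convergence on
compact subsets). -/
def constantFunctions (X : Type*) [TopologicalSpace X] : Submodule ℝ C(X, ℝ) where
  carrier := {g | ∃ c : ℝ, ∀ x, g x = c}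
  zero_mem' := ⟨0, fun _ => rfl⟩
  add_mem' := by
    rintro g h ⟨c, hc⟩ ⟨d, hd⟩
    exact ⟨c + d, fun x => by simp [hc x, hd x]⟩
  smul_mem' := by
    rintro a g ⟨c, hc⟩
    exact ⟨a * c, fun x => by simp [hc x]⟩

/-- The map `i_H` sending `x` to the class of `y ↦ d(x, y)` in `C_*(X) = C(X) / constants`. -/
def distClass {X : Type*} [MetricSpace X] (x : X) : C(X, ℝ) ⧸ constantFunctions X :=
  Submodule.Quotient.mk (⟨fun y => dist x y, by fun_prop⟩ : C(X, ℝ))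

/-- The horofunction compactification: the closure of `i_H(X)` in `C_*(X)`. -/
abbrev HorofunctionCompactification (X : Type*) [MetricSpace X] : Type _ :=
  closure (Set.range (distClass (X := X)))

/-- `i_H` as a map into the horofunction compactification. -/
def horoEmbedding (X : Type*) [MetricSpace X] (x : X) : HorofunctionCompactification X :=
  ⟨distClass x, subset_closure ⟨x, rfl⟩⟩

/-- Two compactifications `i₁ : X → Y₁` and `i₂ : X → Y₂` are topologically equivalent if some
homeomorphism `h : Y₁ → Y₂` satisfies `h ∘ i₁ = i₂`. -/
def TopologicallyEquivalent {X Y₁ Y₂ : Type*} [TopologicalSpace Y₁] [TopologicalSpace Y₂]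
    (i₁ : X → Y₁) (i₂ : X → Y₂) : Prop :=
  ∃ h : Y₁ ≃ₜ Y₂, ∀ x, h (i₁ x) = i₂ x

/-! ### Non-expanding self-maps -/

/-- All forward orbits diverge: none has a bounded subsequence. -/
def HasDivergingOrbits {X : Type*} [MetricSpace X] (f : X → X) : Prop :=
  ∀ x : X, Tendsto (fun n : ℕ => f^[n] x) atTop (Bornology.cobounded X)

/-- `ζ` is a Denjoy–Wolff point of `f`: every forward orbit converges to `ζ`. -/
def IsDenjoyWolffPoint {X : Type*} [MetricSpace X] (f : X → X) (ζ : GromovBoundary X) : Prop :=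
  ∀ x : X, Tendsto (fun n : ℕ => GromovCompactification.point (f^[n] x)) atTop
    (𝓝 (GromovCompactification.ideal ζ))

/-- The filter of points `z` of `X` converging to the boundary point `η`. -/
def approach {X : Type*} [MetricSpace X] (η : GromovBoundary X) : Filter X :=
  comap GromovCompactification.point (𝓝 (GromovCompactification.ideal η))

/-- The dilation `λ_{η,p} ∈ (0, +∞]` of `f` at `η` with base point `p`, where
`log λ_{η,p} = liminf_{z → η} (d(z, p) - d(f(z), p))`. -/
noncomputable def dilation {X : Type*} [MetricSpace X] (f : X → X) (η : GromovBoundary X) (p : X) :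
    ℝ≥0∞ :=
  EReal.exp (liminf (fun z : X => ((dist z p - dist (f z) p : ℝ) : EReal)) (approach η))

/-- The geodesic region `A(γ, R)`. -/
def geodesicRegion {X : Type*} [MetricSpace X] (γ : GeodesicRay X) (R : ℝ) : Set X :=
  {x | Metric.infDist x (Set.range γ.1) < R}

/-- `g` has geodesic limit `ξ` at `η`: it converges to `ξ` along every sequence that converges
to `η` inside a geodesic region with vertex `η`. -/
def HasGeodesicLimit {X Y : Type*} [MetricSpace X] [TopologicalSpace Y] (g : X → Y)
    (η : GromovBoundary X) (ξ : Y) : Prop :=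
  ∀ u : ℕ → X,
    Tendsto (fun n => GromovCompactification.point (u n)) atTop
      (𝓝 (GromovCompactification.ideal η)) →
    (∃ (γ : GeodesicRay X) (R : ℝ), γ.endpoint = η ∧ 0 < R ∧ ∀ n, u n ∈ geodesicRegion γ R) →
    Tendsto (fun n => g (u n)) atTop (𝓝 ξ)

/-- `η` is a boundary regular fixed point of `f`: the dilation of `f` at `η` is finite and `f` has
geodesic limit `η` at `η`. -/
def IsBoundaryRegularFixedPoint {X : Type*} [MetricSpace X] (f : X → X)
    (η : GromovBoundary X) : Prop :=
  (∀ p : X, dilation f η p < ⊤) ∧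
    HasGeodesicLimit (fun x => GromovCompactification.point (f x)) η
      (GromovCompactification.ideal η)

/-- `c` is the divergence rate `c(f)`, the limit of `d(x, fⁿ(x)) / n` for every `x`. -/
def IsDivergenceRate {X : Type*} [MetricSpace X] (f : X → X) (c : ℝ) : Prop :=
  ∀ x : X, Tendsto (fun n : ℕ => dist x (f^[n] x) / n) atTop (𝓝 c)

/-! ### Convergence to boundary points -/

section Boundary

variable {X : Type*} [MetricSpace X]

/-! The equivalence of the compactifications serves twice: it makes the Gromov compactification
Hausdorff, and it turns `d(z, y) - d(z, p)` into a function with a genuine limit `B η y p` as `z →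
η` (`exists_isBusemann`). So `B η` is an exact cocycle, and horoballs at `η` lose no additive
constant.

At record times `n` of `d(fⁿ x, x) - n c'`, non-expansion bounds `d(fⁿ x, fᵏ x) - d(fⁿ x, x)` by `-k
c'`; in the limit `B ζ (fᵏ x) x ≤ -k c'` (`orbit_le`). With `c' = 0` the orbit stays in a horoball
at `ζ` and leaves bounded sets, so it converges to `ζ`. With `c'` increasing to `c(f)`, `f` moves
every point towards `ζ` by at least `c(f)`.

Conversely, Julia's lemma (`julia`) turns a bound on the dilation at a fixed boundary point into a
bound on `B η (f x) x`. At dilation at most one it makes horoballs at `η` invariant, so orbits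
converge to `η`. At `ζ`, a dilation below `exp (-c(f))` would make orbits escape faster than `c(f)`;
a larger one would make them too slow, since `n c(f) ≤ d(p, fⁿ p)` by Fekete's lemma. -/

theorem tendsto_approach_iff {ι : Type*} {l : Filter ι} {u : ι → X} {η : GromovBoundary X} :
    Tendsto u l (approach η) ↔
      Tendsto (fun i => GromovCompactification.point (u i)) l
        (𝓝 (GromovCompactification.ideal η)) :=
  tendsto_comap_iff

/-- Only this direction is immediate: open sets around `η` contain basic sets, but basic sets are
not shown to be neighbourhoods. -/
theorem tendsto_approach_of_gromovNhd {ι : Type*} {l : Filter ι} {u : ι → X}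
    {η : GromovBoundary X}
    (h : ∀ p R, ∀ᶠ i in l, GromovCompactification.point (u i) ∈ gromovNhd p η R) :
    Tendsto u l (approach η) := by
  rw [tendsto_approach_iff, tendsto_nhds]
  intro s hs hη
  rcases isEmpty_or_nonempty X with hX | ⟨⟨p⟩⟩
  · exact Eventually.of_forall fun i => (hX.false (u i)).elim
  · obtain ⟨R, hR⟩ := hs.2 η hη p
    filter_upwards [h p R] with i hi using hR hi

theorem GeodesicRay.dist_eq (γ : GeodesicRay X) (s t : ℝ≥0) :
    dist (γ.1 s) (γ.1 t) = |(s : ℝ) - t| := by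
  rw [γ.2.dist_eq, NNReal.dist_eq]

theorem GeodesicRay.tendsto_approach (γ : GeodesicRay X) :
    Tendsto γ.1 atTop (approach γ.endpoint) := by
  refine tendsto_approach_of_gromovNhd fun p R => ?_
  filter_upwards [eventually_ge_atTop (R + dist (γ.1 0) p).toNNReal] with s hs
  refine ⟨γ, rfl, ?_⟩
  filter_upwards [eventually_ge_atTop s] with t ht
  have hs' : R + dist (γ.1 0) p ≤ s := Real.toNNReal_le_iff_le_coe.1 hs
  have hst : (s : ℝ) ≤ t := by exact_mod_cast ht
  have h₁ := γ.dist_eq s t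
  have h₂ := γ.dist_eq s 0
  have h₃ := γ.dist_eq t 0
  rw [abs_of_nonpos (by linarith)] at h₁
  rw [NNReal.coe_zero, sub_zero, NNReal.abs_eq] at h₂ h₃
  have h₄ := dist_triangle (γ.1 s) p (γ.1 0)
  have h₅ := dist_triangle (γ.1 t) p (γ.1 0)
  rw [dist_comm p] at h₄ h₅
  unfold gromovProduct
  linarith

theorem GromovBoundary.exists_ray (η : GromovBoundary X) : ∃ γ : GeodesicRay X, γ.endpoint = η :=
  Quotient.exists_rep η

theorem approach_neBot (η : GromovBoundary X) : (approach η).NeBot := by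
  obtain ⟨γ, rfl⟩ := η.exists_ray
  exact γ.tendsto_approach.neBot

theorem continuous_point : Continuous (GromovCompactification.point : X → _) :=
  ⟨fun _ hs => hs.1⟩

theorem eq_of_tendsto_approach [T2Space (GromovCompactification X)] {ι : Type*} {l : Filter ι}
    [l.NeBot] {u : ι → X} {η ξ : GromovBoundary X} (hη : Tendsto u l (approach η))
    (hξ : Tendsto u l (approach ξ)) : η = ξ :=
  GromovCompactification.ideal.inj
    (tendsto_nhds_unique (tendsto_approach_iff.1 hη) (tendsto_approach_iff.1 hξ))

/-- Closed balls are compact, so their images are closed in the Hausdorff compactification and miss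
`η`. -/
theorem approach_le_cobounded [ProperSpace X] [T2Space (GromovCompactification X)]
    (η : GromovBoundary X) : approach η ≤ Bornology.cobounded X := by
  intro s hs
  rcases isEmpty_or_nonempty X with hX | ⟨⟨p⟩⟩
  · rw [Set.eq_univ_of_forall fun x : X => (hX.false x).elim (C := x ∈ s)]
    exact univ_mem
  obtain ⟨r, hr⟩ := (Bornology.isBounded_def.2 (compl_compl s ▸ hs)).subset_closedBall p
  have hK := ((isCompact_closedBall p r).image continuous_point).isClosed
  refine mem_comap.2 ⟨_, hK.isOpen_compl.mem_nhds (x := GromovCompactification.ideal η) ?_, ?_⟩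
  · rintro ⟨x, -, hx⟩
    cases hx
  · intro x hx
    by_contra hxs
    exact hx ⟨x, hr hxs, rfl⟩

/-- In a proper geodesic hyperbolic space, an ultrafilter that leaves all bounded sets converges
to a boundary point. -/
theorem exists_ultrafilter_le_approach [ProperSpace X] (hgeo : IsGeodesicSpace X)
    (hhyp : IsGromovHyperbolic X) (U : Ultrafilter X) (hU : ↑U ≤ Bornology.cobounded X) :
    ∃ ξ : GromovBoundary X, ↑U ≤ approach ξ := by
  obtain ⟨o⟩ : Nonempty X := nonempty_of_neBot (U : Filter X)
  obtain ⟨δ, hδ⟩ := hhyp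
  choose σ hσ₀ hσ₁ hσ using hgeo o
  have hdist : ∀ r, ∀ᶠ z in (U : Filter X), r ≤ dist o z := fun r =>
    (Metric.tendsto_dist_left_cobounded_atTop o).mono_left hU |>.eventually_ge_atTop r
  -- The limit ray is the pointwise limit, along the ultrafilter, of the segments from `o` to `z`.
  have hlim : ∀ t : ℝ≥0, ∃ y, Tendsto (fun z => σ z t) U (𝓝 y) := by
    intro t
    have hball : ∀ᶠ z in (U : Filter X), σ z t ∈ Metric.closedBall o (t : ℝ) := by
      filter_upwards [hdist t] with z hz
      have := hσ z t ⟨t.2, hz⟩ 0 ⟨le_rfl, dist_nonneg⟩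
      rw [hσ₀, sub_zero, NNReal.abs_eq] at this
      exact this.le
    obtain ⟨y, -, hy⟩ := (isCompact_closedBall o (t : ℝ)).ultrafilter_le_nhds
      (U.map fun z => σ z t) (le_principal_iff.2 hball)
    exact ⟨y, hy⟩
  choose γ hγ using hlim
  have hiso : Isometry γ := by
    refine Isometry.of_dist_eq fun s t => ?_
    refine tendsto_nhds_unique ((hγ s).dist (hγ t)) (tendsto_const_nhds.congr' ?_)
    filter_upwards [hdist s, hdist t] with z hs ht
    rw [hσ z s ⟨s.2, hs⟩ t ⟨t.2, ht⟩, NNReal.dist_eq]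
  let ρ : GeodesicRay X := ⟨γ, hiso⟩
  have hγ₀ : γ 0 = o := by
    refine tendsto_nhds_unique (hγ 0) (tendsto_const_nhds.congr fun z => ?_)
    exact (hσ₀ z).symm
  refine ⟨ρ.endpoint, ?_⟩
  refine tendsto_id'.1 (tendsto_approach_of_gromovNhd fun p R => ?_)
  -- Losses: `δ` from hyperbolicity, `1` from replacing `σ z T` by `γ T`, `dist o p` from the change
  -- of base point.
  set T : ℝ≥0 := (R + δ + 1 + dist o p).toNNReal with hT
  have hT' : R + δ + 1 + dist o p ≤ T := Real.le_coe_toNNReal _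
  filter_upwards [hdist T, (hγ T).eventually (Metric.ball_mem_nhds _ one_pos)] with z hz hzT
  refine ⟨ρ, rfl, ?_⟩
  filter_upwards [eventually_ge_atTop T] with t ht
  have ht' : (T : ℝ) ≤ t := by exact_mod_cast ht
  have h₁ := ρ.dist_eq T t
  have h₂ := ρ.dist_eq T 0
  have h₃ := ρ.dist_eq t 0
  rw [abs_of_nonpos (by linarith)] at h₁
  rw [NNReal.coe_zero, sub_zero, NNReal.abs_eq] at h₂ h₃
  change dist (γ T) (γ t) = _ at h₁
  change dist (γ T) (γ 0) = _ at h₂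
  change dist (γ t) (γ 0) = _ at h₃
  change R ≤ gromovProduct p z (γ t)
  rw [hγ₀] at h₂ h₃
  have h₄ := hσ z T ⟨T.2, hz⟩ (dist o z) ⟨dist_nonneg, le_rfl⟩
  rw [hσ₁, abs_of_nonpos (by linarith), dist_comm] at h₄
  have h₅ := dist_triangle z (σ z T) (γ T)
  have h₆ : dist (σ z T) (γ T) < 1 := hzT
  have h₇ := hδ o z (γ T) (γ t)
  have h₈ : (T : ℝ) - 1 ≤ min (gromovProduct o z (γ T)) (gromovProduct o (γ T) (γ t)) := by
    have := dist_comm z o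
    unfold gromovProduct
    exact le_min (by linarith) (by linarith)
  have h₉ := dist_triangle z p o
  have h₁₀ := dist_triangle (γ t) p o
  rw [dist_comm p o] at h₉ h₁₀
  unfold gromovProduct at h₇ h₈ ⊢
  linarith

end Boundary

/-! ### Busemann functions -/

section Busemann

variable {X : Type*} [MetricSpace X]

/-- `B η y p` is the limit of `d(z, y) - d(z, p)` as `z` tends to the boundary point `η`. -/
def IsBusemann (B : GromovBoundary X → X → X → ℝ) : Prop :=
  ∀ η y p, Tendsto (fun z => dist z y - dist z p) (approach η) (𝓝 (B η y p))

namespace IsBusemann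

variable {B : GromovBoundary X → X → X → ℝ}

theorem add (hB : IsBusemann B) (η : GromovBoundary X) (x y z : X) :
    B η x y + B η y z = B η x z := by
  have := approach_neBot η
  refine tendsto_nhds_unique ((hB η x y).add (hB η y z)) ((hB η x z).congr fun w => ?_)
  ring

theorem le_dist (hB : IsBusemann B) (η : GromovBoundary X) (x y : X) : B η x y ≤ dist x y := by
  have := approach_neBot η
  refine le_of_tendsto (hB η x y) (Eventually.of_forall fun z => ?_)
  have := dist_triangle z y x
  rw [dist_comm y x] at this
  linarith

theorem self (hB : IsBusemann B) (η : GromovBoundary X) (x : X) : B η x x = 0 := by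
  linarith [hB.add η x x x]

theorem neg_dist_le (hB : IsBusemann B) (η : GromovBoundary X) (x y : X) :
    -dist x y ≤ B η x y := by
  have h₁ := hB.add η x y x
  have h₂ := hB.le_dist η y x
  rw [dist_comm] at h₂
  rw [hB.self] at h₁
  linarith

theorem ray (hB : IsBusemann B) (γ : GeodesicRay X) (t : ℝ≥0) :
    B γ.endpoint (γ.1 t) (γ.1 0) = -t := by
  refine tendsto_nhds_unique ((hB γ.endpoint (γ.1 t) (γ.1 0)).comp γ.tendsto_approach)
    (tendsto_const_nhds.congr' ?_)
  filter_upwards [eventually_ge_atTop t] with s hs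
  have hs' : (t : ℝ) ≤ s := by exact_mod_cast hs
  have h₁ := γ.dist_eq s t
  have h₂ := γ.dist_eq s 0
  rw [abs_of_nonneg (by linarith)] at h₁
  rw [NNReal.coe_zero, sub_zero, NNReal.abs_eq] at h₂
  rw [Function.comp_apply, h₁, h₂]
  ring

/-- A sequence converges to `η` if its Gromov product with `η` tends to infinity. -/
theorem tendsto_approach (hB : IsBusemann B) {ι : Type*} {l : Filter ι} {u : ι → X}
    {η : GromovBoundary X} {p : X}
    (h : Tendsto (fun i => dist (u i) p - B η (u i) p) l atTop) : Tendsto u l (approach η) := by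
  obtain ⟨γ, rfl⟩ := η.exists_ray
  refine tendsto_approach_of_gromovNhd fun q R => ?_
  -- The last two terms pay for moving the base point from `p` to `q`.
  filter_upwards [h.eventually_gt_atTop (2 * R + dist p q + B γ.endpoint p q)] with i hi
  refine ⟨γ, rfl, ?_⟩
  have hlim := ((hB γ.endpoint (u i) q).comp γ.tendsto_approach).eventually_lt_const
    (u := dist (u i) q - 2 * R) (by
      have h₁ := hB.add γ.endpoint (u i) p q
      have h₂ := dist_triangle (u i) q p
      rw [dist_comm q p] at h₂
      linarith)
  filter_upwards [hlim] with t ht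
  rw [Function.comp_apply, dist_comm _ (u i)] at ht
  unfold gromovProduct
  linarith

theorem tendsto_approach_of_atBot (hB : IsBusemann B) {ι : Type*} {l : Filter ι} {u : ι → X}
    {η : GromovBoundary X} {p : X} (h : Tendsto (fun i => B η (u i) p) l atBot) :
    Tendsto u l (approach η) :=
  hB.tendsto_approach (p := p) <| tendsto_atTop_mono
    (fun i => by
      change -B η (u i) p ≤ _
      linarith [dist_nonneg (x := u i) (y := p)]) (tendsto_neg_atBot_atTop.comp h)

/-- An orbit staying in a horoball centred at `η` and leaving bounded sets converges to `η`. -/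
theorem tendsto_approach_of_le (hB : IsBusemann B) {ι : Type*} {l : Filter ι} {u : ι → X}
    {η : GromovBoundary X} {p : X} {C : ℝ} (hu : Tendsto u l (Bornology.cobounded X))
    (h : ∀ i, B η (u i) p ≤ C) : Tendsto u l (approach η) :=
  hB.tendsto_approach (p := p) <| tendsto_atTop_mono (fun i => by
      change dist (u i) p + -C ≤ _
      linarith [h i])
    (tendsto_atTop_add_const_right _ _ ((Metric.tendsto_dist_right_cobounded_atTop p).comp hu))

end IsBusemann

/-! ### Non-expanding maps -/

variable {B : GromovBoundary X → X → X → ℝ} {f : X → X}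

theorem LipschitzWith.dist_iterate_le (hf : LipschitzWith 1 f) (n : ℕ) (x y : X) :
    dist (f^[n] x) (f^[n] y) ≤ dist x y := by
  simpa using (hf.iterate n).dist_le_mul x y

/-- If the displacement of `f` in the direction of `η` is at most `A`, so is that of `f^[n]`,
up to the factor `n`. -/
theorem IsBusemann.iterate_le (hB : IsBusemann B) {η : GromovBoundary X} {A : ℝ}
    (h : ∀ x, B η (f x) x ≤ A) (n : ℕ) (x : X) : B η (f^[n] x) x ≤ n * A := by
  induction n with
  | zero => simp [hB.self]
  | succ n ih =>
    rw [Function.iterate_succ_apply']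
    have := hB.add η (f (f^[n] x)) (f^[n] x) x
    push_cast
    linarith [h (f^[n] x)]

/-- Julia's lemma. -/
theorem IsBusemann.julia [ProperSpace X] [T2Space (GromovCompactification X)]
    (hgeo : IsGeodesicSpace X) (hhyp : IsGromovHyperbolic X) (hB : IsBusemann B)
    (hf : LipschitzWith 1 f) {η : GromovBoundary X} {γ : GeodesicRay X} (hγ : γ.endpoint = η)
    (hlim : Tendsto (fun n : ℕ => f (γ.1 n)) atTop (approach η)) {p : X} {A : ℝ}
    (hA : ∃ᶠ z in approach η, dist z p - dist (f z) p ≤ A) (x : X) : B η (f x) x ≤ A := by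
  have := frequently_iff_neBot.1 hA
  obtain ⟨U, hU⟩ := Ultrafilter.exists_le (approach η ⊓ 𝓟 {z | dist z p - dist (f z) p ≤ A})
  have hUη : (U : Filter X) ≤ approach η := hU.trans inf_le_left
  have hUA : ∀ᶠ z in (U : Filter X), dist z p - dist (f z) p ≤ A :=
    le_principal_iff.1 (hU.trans inf_le_right)
  have hcob : Tendsto f U (Bornology.cobounded X) := by
    rw [← Metric.tendsto_dist_right_atTop_iff p]
    refine tendsto_atTop_mono' _ (hUA.mono fun z hz => ?_) (tendsto_atTop_add_const_right _ (-A)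
      ((Metric.tendsto_dist_right_cobounded_atTop p).mono_left
        (hUη.trans (approach_le_cobounded η))))
    linarith
  obtain ⟨ξ, hξ⟩ := exists_ultrafilter_le_approach hgeo hhyp (U.map f) hcob
  -- With `ξ` the limit of `f z`, non-expansion sends horoballs at `η` into horoballs at `ξ`.
  have key : ∀ y, B ξ (f y) p ≤ B η y p + A := by
    intro y
    refine le_of_tendsto_of_tendsto ((hB ξ (f y) p).comp hξ)
      (((hB η y p).mono_left hUη).add_const A) (hUA.mono fun z hz => ?_)
    have := hf.dist_le_mul z y
    simp only [NNReal.coe_one, one_mul] at this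
    rw [Function.comp_apply]
    linarith
  -- Along the ray `B η` tends to `-∞`, so `key` forces `f (γ n) → ξ`, whereas `hlim` gives the
  -- limit `η`.
  have hξη : ξ = η := by
    refine eq_of_tendsto_approach (hB.tendsto_approach_of_atBot (p := p) ?_) hlim
    refine tendsto_atBot_mono (fun n => key (γ.1 n)) ?_
    have : ∀ n : ℕ, B η (γ.1 n) p + A = -(n : ℝ) + (B η (γ.1 0) p + A) := by
      intro n
      rw [← hB.add η (γ.1 n) (γ.1 0) p, ← hγ, hB.ray]
      simp
      ring
    simp only [this]
    exact tendsto_atBot_add_const_right _ _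
      (tendsto_neg_atTop_atBot.comp tendsto_natCast_atTop_atTop)
  subst hξη
  linarith [key x, hB.add ξ (f x) x p]

/-- Along record times of `d(f^[n] x, x) - n * c`, the orbit moves towards its limit point at speed
at least `c`. -/
theorem IsBusemann.orbit_le (hB : IsBusemann B) (hf : LipschitzWith 1 f) {ζ : GromovBoundary X}
    {x : X} {c : ℝ} {l : Filter ℕ} [l.NeBot] (hl : l ≤ atTop)
    (hζ : Tendsto (fun n => f^[n] x) l (approach ζ))
    (hrec : ∀ᶠ n in l, ∀ k < n, dist (f^[k] x) x - k * c < dist (f^[n] x) x - n * c) (k : ℕ) :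
    B ζ (f^[k] x) x ≤ -(k * c) := by
  refine le_of_tendsto ((hB ζ (f^[k] x) x).comp hζ) ?_
  filter_upwards [hrec, hl (eventually_ge_atTop k)] with n hn hkn
  obtain ⟨m, rfl⟩ := Nat.exists_eq_add_of_le hkn
  -- The record beats only strictly earlier times, so `k = 0` is separate.
  have h₁ : dist (f^[m] x) x - m * c ≤ dist (f^[k + m] x) x - (k + m : ℕ) * c := by
    rcases Nat.eq_zero_or_pos k with rfl | hk
    · simp
    · exact (hn m (by omega)).le
  have h₂ := hf.dist_iterate_le k (f^[m] x) x
  rw [← Function.iterate_add_apply] at h₂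
  rw [Function.comp_apply]
  push_cast at h₁
  linarith

/-- The Denjoy–Wolff theorem for non-expanding maps with diverging orbits. -/
theorem IsBusemann.exists_isDenjoyWolffPoint [ProperSpace X] [Nonempty X]
    (hgeo : IsGeodesicSpace X) (hhyp : IsGromovHyperbolic X) (hB : IsBusemann B)
    (hf : LipschitzWith 1 f) (hdiv : HasDivergingOrbits f) :
    ∃ ζ : GromovBoundary X, IsDenjoyWolffPoint f ζ := by
  obtain ⟨x⟩ := ‹Nonempty X›
  -- Speed zero, written in the shape that `orbit_le` expects.
  have ha : Tendsto (fun n => dist (f^[n] x) x - (n : ℝ) * 0) atTop atTop := by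
    simp only [mul_zero, sub_zero]
    exact (Metric.tendsto_dist_right_cobounded_atTop x).comp (hdiv x)
  have hfreq := frequently_iff_neBot.1 (frequently_high_scores ha)
  obtain ⟨V, hV⟩ := Ultrafilter.exists_le (atTop ⊓ 𝓟 {n : ℕ | ∀ k < n,
    dist (f^[k] x) x - (k : ℝ) * 0 < dist (f^[n] x) x - (n : ℝ) * 0})
  obtain ⟨ζ, hζ⟩ := exists_ultrafilter_le_approach hgeo hhyp (V.map fun n => f^[n] x)
    ((hdiv x).mono_left (hV.trans inf_le_left))
  have hle := hB.orbit_le hf (hV.trans inf_le_left) hζ (le_principal_iff.1 (hV.trans inf_le_right))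
  refine ⟨ζ, fun y => tendsto_approach_iff.1 ?_⟩
  refine hB.tendsto_approach_of_le (p := x) (C := dist y x) (hdiv y) fun n => ?_
  have h₁ := hB.add ζ (f^[n] y) (f^[n] x) x
  have h₂ := hB.le_dist ζ (f^[n] y) (f^[n] x)
  have h₃ := hf.dist_iterate_le n y x
  linarith [hle n]

/-! ### The divergence rate -/

theorem LipschitzWith.subadditive_dist_iterate (hf : LipschitzWith 1 f) (x : X) :
    Subadditive fun n => dist x (f^[n] x) := by
  intro m n
  have h₁ := dist_triangle x (f^[m] x) (f^[m + n] x)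
  have h₂ := hf.dist_iterate_le m x (f^[n] x)
  rw [← Function.iterate_add_apply] at h₂
  linarith

theorem bddBelow_dist_iterate_div (f : X → X) (x : X) :
    BddBelow (Set.range fun n : ℕ => dist x (f^[n] x) / n) :=
  ⟨0, by rintro _ ⟨n, rfl⟩; positivity⟩

theorem LipschitzWith.exists_isDivergenceRate [Nonempty X] (hf : LipschitzWith 1 f) :
    ∃ c, IsDivergenceRate f c := by
  obtain ⟨x⟩ := ‹Nonempty X›
  have hx := (hf.subadditive_dist_iterate x).tendsto_lim (bddBelow_dist_iterate_div f x)
  refine ⟨(hf.subadditive_dist_iterate x).lim, fun y => ?_⟩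
  have h₀ : Tendsto (fun n : ℕ => 2 * dist x y / (n : ℝ)) atTop (𝓝 0) :=
    tendsto_const_div_atTop_nhds_zero_nat _
  refine tendsto_of_tendsto_of_tendsto_of_le_of_le (by simpa using hx.sub h₀)
    (by simpa using hx.add h₀) (fun n => ?_) fun n => ?_
  all_goals
    have h₁ := hf.dist_iterate_le n x y
    have h₂ := dist_triangle4 x y (f^[n] y) (f^[n] x)
    have h₃ := dist_triangle4 y x (f^[n] x) (f^[n] y)
    rw [dist_comm (f^[n] y)] at h₂
    rw [dist_comm y x] at h₃
    beta_reduce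
  · rw [← sub_div]
    gcongr
    linarith
  · rw [← add_div]
    gcongr
    linarith

/-- By Fekete's lemma the limit is also the infimum of the quotients. -/
theorem IsDivergenceRate.mul_le_dist {c : ℝ} (hc : IsDivergenceRate f c) (hf : LipschitzWith 1 f)
    (n : ℕ) (x : X) : n * c ≤ dist x (f^[n] x) := by
  rcases Nat.eq_zero_or_pos n with rfl | hn
  · simp
  have hb := bddBelow_dist_iterate_div f x
  have hs := hf.subadditive_dist_iterate x
  have h := hs.lim_le_div hb hn.ne'
  rw [tendsto_nhds_unique (hs.tendsto_lim hb) (hc x), le_div_iff₀ (by positivity)] at h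
  linarith

theorem IsDivergenceRate.nonneg [Nonempty X] {c : ℝ} (hc : IsDivergenceRate f c) : 0 ≤ c :=
  ge_of_tendsto' (hc (Classical.arbitrary X)) fun n => by positivity

/-- `f` moves every point towards the Denjoy–Wolff point by at least the divergence rate. -/
theorem IsBusemann.le_neg_divergenceRate (hB : IsBusemann B) (hf : LipschitzWith 1 f)
    {ζ : GromovBoundary X} (hζ : IsDenjoyWolffPoint f ζ) {c : ℝ} (hc : IsDivergenceRate f c)
    (x : X) : B ζ (f x) x ≤ -c := by
  -- At speed `c` the difference may stay bounded; at speed `c - ε` it tends to infinity, so records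
  -- recur.
  refine le_of_forall_pos_le_add fun ε hε => ?_
  have ha : Tendsto (fun n : ℕ => dist (f^[n] x) x - n * (c - ε)) atTop atTop := by
    refine tendsto_atTop_mono (fun n => ?_) (tendsto_natCast_atTop_atTop.atTop_mul_const hε)
    have := hc.mul_le_dist hf n x
    rw [dist_comm] at this
    linarith
  have hfreq := frequently_iff_neBot.1 (frequently_high_scores ha)
  have := hB.orbit_le (c := c - ε) hf inf_le_left ((tendsto_approach_iff.2 (hζ x)).mono_left inf_le_left)
    (le_principal_iff.1 (inf_le_right (a := atTop))) 1
  simp only [Function.iterate_one, Nat.cast_one, one_mul] at this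
  linarith

/-- A non-expanding map has geodesic limit `ζ` at `ζ` if it preserves the horoballs at `ζ`. -/
theorem IsBusemann.hasGeodesicLimit [ProperSpace X] [T2Space (GromovCompactification X)]
    (hB : IsBusemann B) {ζ : GromovBoundary X} (h : ∀ x, B ζ (f x) x ≤ 0) :
    HasGeodesicLimit (fun x => GromovCompactification.point (f x)) ζ
      (GromovCompactification.ideal ζ) := by
  rintro u hu ⟨γ, R, rfl, -, hR⟩
  rw [← tendsto_approach_iff] at hu ⊢
  refine hB.tendsto_approach_of_atBot (p := γ.1 0) ?_
  have hcob := (Metric.tendsto_dist_right_cobounded_atTop (γ.1 0)).comp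
    (hu.mono_right (approach_le_cobounded _))
  refine tendsto_atBot_mono (fun n => ?_)
    (tendsto_atBot_add_const_right _ (2 * R) (tendsto_neg_atTop_atBot.comp hcob))
  -- Near `γ t` the Busemann function is at most `R - t` and the distance to `γ 0` at most `R + t`.
  obtain ⟨_, ⟨t, rfl⟩, ht⟩ := (Metric.infDist_lt_iff (Set.range_nonempty _)).1 (hR n)
  have h₁ := hB.add γ.endpoint (f (u n)) (u n) (γ.1 0)
  have h₂ := hB.add γ.endpoint (u n) (γ.1 t) (γ.1 0)
  have h₃ := hB.ray γ t
  have h₄ := hB.le_dist γ.endpoint (u n) (γ.1 t)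
  have h₅ := dist_triangle (u n) (γ.1 t) (γ.1 0)
  have h₆ := γ.dist_eq t 0
  rw [NNReal.coe_zero, sub_zero, NNReal.abs_eq] at h₆
  simp only [Function.comp_apply]
  linarith [h (u n)]

theorem HasGeodesicLimit.tendsto_ray {η : GromovBoundary X}
    (h : HasGeodesicLimit (fun x => GromovCompactification.point (f x)) η
      (GromovCompactification.ideal η)) {γ : GeodesicRay X} (hγ : γ.endpoint = η) :
    Tendsto (fun n : ℕ => f (γ.1 n)) atTop (approach η) := by
  refine tendsto_approach_iff.2 (h (fun n => γ.1 n) (tendsto_approach_iff.1 ?_)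
    ⟨γ, 1, hγ, one_pos, fun n => ?_⟩)
  · exact hγ ▸ γ.tendsto_approach.comp tendsto_natCast_atTop_atTop
  · change Metric.infDist _ _ < 1
    rw [Metric.infDist_zero_of_mem (Set.mem_range_self _)]
    exact one_pos

/-- The logarithm of the dilation at the Denjoy–Wolff point is minus the divergence rate. -/
theorem IsBusemann.liminf_eq_neg_divergenceRate [ProperSpace X]
    [T2Space (GromovCompactification X)] (hgeo : IsGeodesicSpace X) (hhyp : IsGromovHyperbolic X)
    (hB : IsBusemann B) (hf : LipschitzWith 1 f)
    {ζ : GromovBoundary X} (hζ : IsDenjoyWolffPoint f ζ)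
    (hlim : HasGeodesicLimit (fun x => GromovCompactification.point (f x)) ζ
      (GromovCompactification.ideal ζ)) {c : ℝ} (hc : IsDivergenceRate f c) (p : X) :
    liminf (fun z : X => ((dist z p - dist (f z) p : ℝ) : EReal)) (approach ζ) =
      ((-c : ℝ) : EReal) := by
  refine le_antisymm (le_of_not_gt fun hlt => ?_) (le_of_not_gt fun hlt => ?_)
  -- Summing the decrement bound along the orbit gives `d(p, fⁿ p) ≤ const - n r` with `-r < c`.
  · obtain ⟨r, hcr, hr⟩ := EReal.lt_iff_exists_real_btwn.1 hlt
    have hcr' : -c < r := by exact_mod_cast hcr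
    have hev := (tendsto_approach_iff.2 (hζ p)).eventually (eventually_lt_of_lt_liminf hr)
    obtain ⟨N, hN⟩ := eventually_atTop.1 hev
    have hk : ∀ k : ℕ, dist p (f^[N + k] p) ≤ dist p (f^[N] p) - k * r := by
      intro k
      induction k with
      | zero => simp
      | succ k ih =>
        have := EReal.coe_lt_coe_iff.1 (hN (N + k) (Nat.le_add_right N k))
        rw [← Function.iterate_succ_apply' f, dist_comm _ p, dist_comm _ p] at this
        rw [← Nat.add_assoc]
        push_cast
        linarith
    have hpos : 0 < c + r := by linarith
    obtain ⟨k, hk'⟩ := exists_nat_gt ((dist p (f^[N] p) - N * c) / (c + r))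
    rw [div_lt_iff₀ hpos] at hk'
    have := hc.mul_le_dist hf (N + k) p
    push_cast at this
    linarith [hk k]
  -- Julia's lemma, iterated, gives `d(p, fⁿ p) ≥ -n r` with `-r > c`.
  · obtain ⟨r, hr, hcr⟩ := EReal.lt_iff_exists_real_btwn.1 hlt
    have hcr' : r < -c := by exact_mod_cast hcr
    obtain ⟨γ, hγ⟩ := ζ.exists_ray
    have hfreq := (frequently_lt_of_liminf_lt (by isBoundedDefault) hr).mono
      fun z hz => (EReal.coe_lt_coe_iff.1 hz).le
    have hle := hB.julia hgeo hhyp hf hγ (hlim.tendsto_ray hγ) hfreq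
    have := (hc p).eventually_lt_const (show c < -r by linarith)
    obtain ⟨n, hn, hn₀⟩ := (this.and (eventually_gt_atTop 0)).exists
    have hn' : (0 : ℝ) < n := by exact_mod_cast hn₀
    rw [div_lt_iff₀ hn'] at hn
    have h₁ := hB.iterate_le hle n p
    have h₂ := hB.neg_dist_le ζ (f^[n] p) p
    rw [dist_comm] at h₂
    linarith

/-- A boundary regular fixed point with dilation at most one attracts all orbits. -/
theorem IsBoundaryRegularFixedPoint.isDenjoyWolffPoint [ProperSpace X]
    [T2Space (GromovCompactification X)] (hgeo : IsGeodesicSpace X) (hhyp : IsGromovHyperbolic X)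
    (hB : IsBusemann B) (hf : LipschitzWith 1 f) (hdiv : HasDivergingOrbits f)
    {η : GromovBoundary X} (hη : IsBoundaryRegularFixedPoint f η) {p : X}
    (hp : dilation f η p ≤ 1) : IsDenjoyWolffPoint f η := by
  obtain ⟨γ, hγ⟩ := η.exists_ray
  have hle : ∀ x, B η (f x) x ≤ 0 := by
    -- A liminf at most `0` gives frequent bounds only by positive `ε`.
    refine fun x => le_of_forall_pos_le_add fun ε hε => ?_
    rw [zero_add]
    refine hB.julia hgeo hhyp hf hγ (hη.2.tendsto_ray hγ) (p := p) ?_ x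
    have hlt : liminf (fun z : X => ((dist z p - dist (f z) p : ℝ) : EReal)) (approach η) <
        (ε : EReal) := (EReal.exp_le_one_iff.1 hp).trans_lt (by exact_mod_cast hε)
    exact (frequently_lt_of_liminf_lt (by isBoundedDefault) hlt).mono
      fun z hz => (EReal.coe_lt_coe_iff.1 hz).le
  refine fun x => tendsto_approach_iff.1
    (hB.tendsto_approach_of_le (p := x) (C := 0) (hdiv x) fun n => ?_)
  simpa using hB.iterate_le hle n x

end Busemann

/-! ### Equivalence of the two compactifications -/

section Equivalence

variable {X : Type*} [MetricSpace X]

/-- Closedness makes the quotient by constants Hausdorff. -/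
theorem isClosed_constantFunctions (X : Type*) [TopologicalSpace X] :
    IsClosed (constantFunctions X : Set C(X, ℝ)) := by
  have : (constantFunctions X : Set C(X, ℝ)) = ⋂ (x : X) (y : X), {g | g x = g y} := by
    ext g
    simp only [Set.mem_iInter]
    constructor
    · rintro ⟨c, hc⟩ x y
      exact (hc x).trans (hc y).symm
    · intro h
      rcases isEmpty_or_nonempty X with hX | ⟨⟨p⟩⟩
      · exact ⟨0, fun x => (hX.false x).elim⟩
      · exact ⟨g p, fun x => h x p⟩
  rw [this]
  exact isClosed_iInter fun x => isClosed_iInter fun y =>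
    isClosed_eq (by fun_prop) (by fun_prop)

/-- The difference `g y - g p` of the values at two points of a class of functions modulo
constants. -/
noncomputable def evalDifference (y p : X) : C(X, ℝ) ⧸ constantFunctions X →ₗ[ℝ] ℝ :=
  (constantFunctions X).liftQ
    { toFun := fun g => g y - g p
      map_add' := fun g h => by simp; ring
      map_smul' := fun a g => by simp; ring }
    (by
      rintro g ⟨c, hc⟩
      simp [hc])

theorem continuous_evalDifference (y p : X) : Continuous (evalDifference y p) := by
  refine (constantFunctions X).isQuotientMap_mkQ.continuous_iff.2 ?_
  change Continuous fun g : C(X, ℝ) => g y - g p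
  fun_prop

theorem TopologicallyEquivalent.t2Space
    (h : TopologicallyEquivalent (horoEmbedding X)
      (GromovCompactification.point : X → GromovCompactification X)) :
    T2Space (GromovCompactification X) := by
  obtain ⟨e, -⟩ := h
  have := isClosed_constantFunctions X
  exact e.t2Space

/-- Differences of values are continuous on the horofunction compactification, and the homeomorphism
carries `z → η` to convergence there. -/
theorem TopologicallyEquivalent.exists_isBusemann
    (h : TopologicallyEquivalent (horoEmbedding X)
      (GromovCompactification.point : X → GromovCompactification X)) :
    ∃ B : GromovBoundary X → X → X → ℝ, IsBusemann B := by
  obtain ⟨e, he⟩ := h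
  refine ⟨fun η y p => evalDifference y p (e.symm (.ideal η)).1, fun η y p => ?_⟩
  have h₁ : Tendsto (fun z => e.symm (.point z)) (approach η) (𝓝 (e.symm (.ideal η))) :=
    (e.symm.continuous.tendsto _).comp tendsto_comap
  refine (((continuous_evalDifference y p).comp continuous_subtype_val).tendsto _).comp h₁
    |>.congr fun z => ?_
  simp only [Function.comp_apply, ← he, e.symm_apply_apply]
  rfl

end Equivalence

theorem mainTheorem8 {X : Type*} [MetricSpace X] [ProperSpace X] [Nonempty X]
    (hgeo : IsGeodesicSpace X) (hhyp : IsGromovHyperbolic X)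
    (hequiv : TopologicallyEquivalent (horoEmbedding X)
      (GromovCompactification.point : X → GromovCompactification X))
    (f : X → X) (hf : LipschitzWith 1 f) (hdiv : HasDivergingOrbits f) :
    (∃! ζ : GromovBoundary X, IsDenjoyWolffPoint f ζ) ∧
    ∀ ζ : GromovBoundary X, IsDenjoyWolffPoint f ζ →
      IsBoundaryRegularFixedPoint f ζ ∧
      (∀ p : X, dilation f ζ p ≤ 1) ∧
      (∀ η : GromovBoundary X, IsBoundaryRegularFixedPoint f η →
        ∀ p : X, dilation f η p ≤ 1 → η = ζ) ∧
      ∃ c : ℝ, IsDivergenceRate f c ∧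
        ∀ p : X, (c : EReal) = -ENNReal.log (dilation f ζ p) := by
  have := hequiv.t2Space
  obtain ⟨B, hB⟩ := hequiv.exists_isBusemann
  obtain ⟨ζ, hζ⟩ := hB.exists_isDenjoyWolffPoint hgeo hhyp hf hdiv
  have huniq : ∀ ξ η : GromovBoundary X, IsDenjoyWolffPoint f ξ → IsDenjoyWolffPoint f η →
      ξ = η := fun ξ η hξ hη =>
    eq_of_tendsto_approach (tendsto_approach_iff.2 (hξ (Classical.arbitrary X)))
      (tendsto_approach_iff.2 (hη _))
  refine ⟨⟨ζ, hζ, fun η hη => huniq η ζ hη hζ⟩, ?_⟩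
  clear hζ ζ
  intro ζ hζ
  obtain ⟨c, hc⟩ := hf.exists_isDivergenceRate
  have hle := hB.le_neg_divergenceRate hf hζ hc
  have hlim := hB.hasGeodesicLimit fun x => (hle x).trans (neg_nonpos.2 hc.nonneg)
  have hdil : ∀ p, dilation f ζ p = EReal.exp ((-c : ℝ) : EReal) := fun p =>
    congrArg EReal.exp (hB.liminf_eq_neg_divergenceRate hgeo hhyp hf hζ hlim hc p)
  refine ⟨⟨fun p => ?_, hlim⟩, fun p => ?_, fun η hη p hp => ?_, c, hc, fun p => ?_⟩
  · rw [hdil, EReal.exp_lt_top_iff]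
    exact EReal.coe_lt_top _
  · rw [hdil, EReal.exp_le_one_iff]
    exact_mod_cast neg_nonpos.2 hc.nonneg
  · exact huniq η ζ (hη.isDenjoyWolffPoint hgeo hhyp hB hf hdiv hp) hζ
  · rw [hdil, EReal.log_exp, EReal.coe_neg, neg_neg]
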